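/- Let $f:\mathbb{P}^1\to\mathbb{P}^1$ be a rational function on the complex projective line $\mathbb{P}^1=\mathbb{P}^1(\mathbb{C})$ of degree $d>1$, and let $c\in\mathbb{P}^1$ be a critical point of $f$ which is not periodic under $f$, i.e. $f^n(c)\neq c$ for every integer $n\ge 1$, where $f^n$ denotes the $n$-th iterate of $f$. Then $$\lim_{n\to\infty}\frac{\log[f^n(c),c]}{d^n+1}=0,$$ where $[\cdot,\cdot]$ is the normalized chordal metric on $\mathbb{P}^1$: for $z,w\in\mathbb{P}^1$ represented by $p=(p_0,p_1)$ and $q=(q_0,q_1)$ in $\mathbb{C}^2\setminus\{0\}$, $$[z,w]=\frac{|p_0q_1-p_1q_0|}{\|p\|\,\|q\|},$$ with $\|\cdot\|$ the Euclidean norm on $\mathbb{C}^2$. -/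

import Mathlib

open Filter Topology
open scoped LinearAlgebra.Projectivization

noncomputable section

/-- The complex projective line: lines through the origin of `ℂ²`, where `ℂ²` carries its
Euclidean norm. -/
abbrev P1 : Type := ℙ ℂ (EuclideanSpace ℂ (Fin 2))

namespace P1

/-- The wedge product `(z₀, z₁) ∧ (w₀, w₁) = z₀ w₁ - z₁ w₀` on `ℂ²`. -/
def wedge (p q : EuclideanSpace ℂ (Fin 2)) : ℂ := p 0 * q 1 - p 1 * q 0

/-- The normalized chordal metric `|p ∧ q| / (‖p‖ ‖q‖)`, with `p`, `q` any representatives of the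
two points (see `chordal_mk`). -/
def chordal (z w : P1) : ℝ := ‖wedge z.rep w.rep‖ / (‖z.rep‖ * ‖w.rep‖)

/-- The chordal metric does not depend on the choice of the representatives. -/
theorem chordal_mk (p q : EuclideanSpace ℂ (Fin 2)) (hp : p ≠ 0) (hq : q ≠ 0) :
    chordal (Projectivization.mk ℂ p hp) (Projectivization.mk ℂ q hq)
      = ‖wedge p q‖ / (‖p‖ * ‖q‖) := by
  obtain ⟨a, ha⟩ := Projectivization.exists_smul_eq_mk_rep ℂ p hp
  obtain ⟨b, hb⟩ := Projectivization.exists_smul_eq_mk_rep ℂ q hq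
  have ha0 : ‖(a : ℂ)‖ ≠ 0 := by simp
  have hb0 : ‖(b : ℂ)‖ ≠ 0 := by simp
  have hw : wedge ((a : ℂ) • p) ((b : ℂ) • q) = (a : ℂ) * (b : ℂ) * wedge p q := by
    simp only [wedge, PiLp.smul_apply, smul_eq_mul]
    ring
  rw [chordal, ← ha, ← hb, Units.smul_def, Units.smul_def, hw, norm_smul, norm_smul, norm_mul,
    norm_mul, show ‖(a : ℂ)‖ * ‖p‖ * (‖(b : ℂ)‖ * ‖q‖)
      = ‖(a : ℂ)‖ * ‖(b : ℂ)‖ * (‖p‖ * ‖q‖) by ring,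
    mul_div_mul_left _ _ (mul_ne_zero ha0 hb0)]

/-- The value at `p` of a pair of polynomials in two variables, as a vector of `ℂ²`. -/
def evalPair (F : Fin 2 → MvPolynomial (Fin 2) ℂ) (p : EuclideanSpace ℂ (Fin 2)) :
    EuclideanSpace ℂ (Fin 2) :=
  WithLp.toLp 2 (fun i => MvPolynomial.eval (fun k => p k) (F i))

/-- `f` is a rational function on the projective line of degree `d`: it is induced by a pair of
homogeneous polynomials of degree `d` whose only common zero is the origin. -/
def IsRational (f : P1 → P1) (d : ℕ) : Prop :=
  ∃ F : Fin 2 → MvPolynomial (Fin 2) ℂ, (∀ i, (F i).IsHomogeneous d) ∧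
    ∀ (p : EuclideanSpace ℂ (Fin 2)) (hp : p ≠ 0),
      ∃ hF : evalPair F p ≠ 0,
        f (Projectivization.mk ℂ p hp) = Projectivization.mk ℂ (evalPair F p) hF

/-- The vector of `ℂ²` whose `i`-th entry is `1` and whose other entry is `z`. -/
def affineVec (i : Fin 2) (z : ℂ) : EuclideanSpace ℂ (Fin 2) :=
  WithLp.toLp 2 (fun k => if k = i then 1 else z)

theorem affineVec_ne_zero (i : Fin 2) (z : ℂ) : affineVec i z ≠ 0 := by
  intro h
  have h1 : affineVec i z i = 0 := by rw [h]; rfl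
  simp [affineVec] at h1

/-- The affine parametrization of the set of points whose `i`-th homogeneous coordinate is not
zero: `z ↦ [1 : z]` for `i = 0` and `z ↦ [z : 1]` for `i = 1`. -/
def affinePoint (i : Fin 2) (z : ℂ) : P1 :=
  Projectivization.mk ℂ (affineVec i z) (affineVec_ne_zero i z)

/-- The affine coordinate, inverse to `affinePoint i`, on the set of points whose `i`-th
homogeneous coordinate is not zero (the index `i + 1` is the other element of `Fin 2`). -/
def affineCoord (i : Fin 2) (x : P1) : ℂ := x.rep (i + 1) / x.rep i

/-- `c` is a critical point of `f`: the derivative of `f` at `c`, read in affine charts around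
`c` and `f c`, exists and vanishes. -/
def IsCriticalPoint (f : P1 → P1) (c : P1) : Prop :=
  ∃ i j : Fin 2, c.rep i ≠ 0 ∧ (f c).rep j ≠ 0 ∧
    HasDerivAt (fun z : ℂ => affineCoord j (f (affinePoint i z))) 0 (affineCoord i c)

end P1

end

/-!
A return `f^n c` at distance `ε` from the critical point `c` that is closer than a fixed
exponential rate makes `c` almost superattracting. Near `c` the map `f` contracts distances by a
factor `O(r)` on the ball of radius `r` (`P1.IsRational.exists_contraction`), while on the whole
line it is Lipschitz with some constant `L` (`P1.IsRational.exists_lipschitz`). Hence, if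
`ε < a / L ^ n` with `a` small, then `f^n` maps the ball of radius `2ε` around `c` into itself and
contracts it by `1/2` (`dist_iterate_le_half_mul`).

Such close returns cannot happen infinitely often unless `c` is periodic
(`eventually_div_pow_le_dist_iterate`). Morally, each close return at a time `n` gives an attracting
fixed point of `f^n` within `2ε` of `c`, to which the orbit of `c` under `f^n` converges; two such
points, for the times `m` and `n`, are both the limit of `f^(mnk) c` as `k → ∞`, hence coincide,
and letting `n → ∞` shows that they equal `c`. The proof replaces the limit by the point
`x = f^(2mn) c`: it is within `2ε_n` of `c` and moved by `f^m` by at most `ε_m / 4`, so that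
`f^m c` is too close to `c` once `ε_n < ε_m / 4`.

So `[f^n c, c] ≥ a / L ^ n` for large `n`, and the logarithm of this bound is linear in `n`, which
is negligible against `d ^ n`.
-/

/-! ### Slow recurrence near a point of strong contraction -/

section Recurrence

variable {X : Type*} [MetricSpace X] {f : X → X} {c : X} {L C ρ : ℝ}

theorem dist_iterate_le_pow_mul (hL : 0 ≤ L) (hf : ∀ x y, dist (f x) (f y) ≤ L * dist x y)
    (n : ℕ) (x y : X) : dist (f^[n] x) (f^[n] y) ≤ L ^ n * dist x y := by
  induction n generalizing x y with
  | zero => simp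
  | succ n ih =>
    rw [Function.iterate_succ_apply, Function.iterate_succ_apply]
    calc dist (f^[n] (f x)) (f^[n] (f y)) ≤ L ^ n * dist (f x) (f y) := ih _ _
      _ ≤ L ^ n * (L * dist x y) := by gcongr; exact hf x y
      _ = L ^ (n + 1) * dist x y := by ring

/-- If `h` contracts by `1/2` the ball around `c` whose radius is twice the displacement of `c`,
then the orbit of `c` stays in this ball. -/
theorem dist_iterate_le_two_mul {h : X → X}
    (hh : ∀ x y, dist x c ≤ 2 * dist (h c) c → dist y c ≤ 2 * dist (h c) c →
      dist (h x) (h y) ≤ 1 / 2 * dist x y) (k : ℕ) :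
    dist (h^[k] c) c ≤ 2 * dist (h c) c := by
  induction k with
  | zero => simp
  | succ k ih =>
    rw [Function.iterate_succ_apply']
    have h1 := hh _ c ih (by simp)
    have h2 := dist_triangle (h (h^[k] c)) (h c) c
    linarith

theorem dist_iterate_succ_le_half_pow {h : X → X}
    (hh : ∀ x y, dist x c ≤ 2 * dist (h c) c → dist y c ≤ 2 * dist (h c) c →
      dist (h x) (h y) ≤ 1 / 2 * dist x y) (k : ℕ) :
    dist (h (h^[k] c)) (h^[k] c) ≤ (1 / 2) ^ k * dist (h c) c := by
  induction k with
  | zero => simp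
  | succ k ih =>
    have hk := dist_iterate_le_two_mul hh k
    have hk' := dist_iterate_le_two_mul hh (k + 1)
    rw [Function.iterate_succ_apply'] at hk' ⊢
    have h1 := hh _ _ hk' hk
    rw [pow_succ]
    linarith

/-- A close return of `c` after `n` steps makes the `n`-th iterate a contraction near `c`. -/
theorem dist_iterate_le_half_mul (hL : 1 < L) (hf : ∀ x y, dist (f x) (f y) ≤ L * dist x y)
    (hC : 0 < C)
    (hloc : ∀ r ≤ ρ, ∀ x y, dist x c ≤ r → dist y c ≤ r → dist (f x) (f y) ≤ C * r * dist x y)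
    {n : ℕ} (hn : 0 < n) (hclose : dist (f^[n] c) c < min (1 / (4 * C)) (ρ / 2) / L ^ n)
    (x y : X) (hx : dist x c ≤ 2 * dist (f^[n] c) c) (hy : dist y c ≤ 2 * dist (f^[n] c) c) :
    dist (f^[n] x) (f^[n] y) ≤ 1 / 2 * dist x y := by
  have hL0 : 0 < L := by linarith
  have hLn : 0 < L ^ n := pow_pos hL0 n
  rw [lt_div_iff₀ hLn, lt_min_iff] at hclose
  obtain ⟨h1, h2⟩ := hclose
  have hL1 : 1 ≤ L ^ n := one_le_pow₀ hL.le
  set e := dist (f^[n] c) c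
  have he0 : 0 ≤ e := dist_nonneg
  have her : 2 * e ≤ ρ := by nlinarith
  have hle := hloc _ her x y hx hy
  obtain ⟨m, rfl⟩ := Nat.exists_eq_add_one.2 hn
  rw [Function.iterate_succ_apply, Function.iterate_succ_apply]
  have hm : L ^ m ≤ L ^ (m + 1) := pow_le_pow_right₀ hL.le (Nat.le_succ m)
  rw [lt_div_iff₀ (by positivity)] at h1
  calc dist (f^[m] (f x)) (f^[m] (f y)) ≤ L ^ m * dist (f x) (f y) :=
        dist_iterate_le_pow_mul hL0.le hf _ _ _
    _ ≤ L ^ (m + 1) * (C * (2 * e) * dist x y) := by gcongr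
    _ = (e * L ^ (m + 1) * (4 * C)) / 2 * dist x y := by ring
    _ ≤ 1 / 2 * dist x y := by gcongr

/-- A point which is not periodic, and near which `f` contracts at least linearly in the distance
to the point, returns to itself at most exponentially closely. -/
theorem eventually_div_pow_le_dist_iterate (hL : 1 < L)
    (hf : ∀ x y, dist (f x) (f y) ≤ L * dist x y) (hC : 0 < C)
    (hloc : ∀ r ≤ ρ, ∀ x y, dist x c ≤ r → dist y c ≤ r → dist (f x) (f y) ≤ C * r * dist x y)
    (hper : c ∉ Function.periodicPts f) :
    ∀ᶠ n : ℕ in atTop, min (1 / (4 * C)) (ρ / 2) / L ^ n ≤ dist (f^[n] c) c := by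
  set a := min (1 / (4 * C)) (ρ / 2)
  by_contra hcon
  have hfreq : ∃ᶠ n : ℕ in atTop, dist (f^[n] c) c < a / L ^ n :=
    fun h => hcon (h.mono fun n hn => not_lt.1 hn)
  obtain ⟨m, hm, hm0⟩ := (hfreq.and_eventually (eventually_gt_atTop 0)).exists
  have hem : 0 < dist (f^[m] c) c :=
    dist_pos.2 fun h => hper (Function.mem_periodicPts.2 ⟨m, hm0, h⟩)
  have hsmall : ∀ᶠ n : ℕ in atTop, a / L ^ n < dist (f^[m] c) c / 4 :=
    (tendsto_const_nhds.div_atTop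
      (tendsto_pow_atTop_atTop_of_one_lt hL)).eventually_lt_const (by positivity)
  obtain ⟨n, ⟨hn, hn0⟩, hns⟩ :=
    ((hfreq.and_eventually (eventually_gt_atTop 0)).and_eventually hsmall).exists
  have hcm := dist_iterate_le_half_mul hL hf hC hloc hm0 hm
  have hcn := dist_iterate_le_half_mul hL hf hC hloc hn0 hn
  -- The point `x = f^(2mn) c` lies on the orbit of `c` under both `f^m` and `f^n`: it is almost
  -- fixed by `f^m`, and much closer to `c` than `f^m c` is.
  set x := (f^[m])^[2 * n] c with hx
  have hx' : x = (f^[n])^[2 * m] c := by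
    rw [hx, ← Function.iterate_mul, ← Function.iterate_mul, show m * (2 * n) = n * (2 * m) by ring]
  have hxn : dist x c ≤ 2 * dist (f^[n] c) c := hx' ▸ dist_iterate_le_two_mul hcn (2 * m)
  have hxm : dist x c ≤ 2 * dist (f^[m] c) c := dist_iterate_le_two_mul hcm (2 * n)
  have hfix : dist (f^[m] x) x ≤ (1 / 2) ^ (2 * n) * dist (f^[m] c) c :=
    dist_iterate_succ_le_half_pow hcm (2 * n)
  have hpow : ((1 : ℝ) / 2) ^ (2 * n) ≤ (1 / 2) ^ 2 :=
    pow_le_pow_of_le_one (by norm_num) (by norm_num) (by omega)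
  have hfix' : dist (f^[m] x) x ≤ (1 / 2) ^ 2 * dist (f^[m] c) c :=
    hfix.trans (by gcongr)
  have h1 := hcm c x (by simp) hxm
  have h2 := dist_triangle4 (f^[m] c) (f^[m] x) x c
  rw [dist_comm c x] at h1
  linarith

theorem tendsto_log_dist_iterate_div (hdist : ∀ x, dist x c ≤ 1) (hL : 1 < L)
    (hf : ∀ x y, dist (f x) (f y) ≤ L * dist x y) (hC : 0 < C) (hρ : 0 < ρ)
    (hloc : ∀ r ≤ ρ, ∀ x y, dist x c ≤ r → dist y c ≤ r → dist (f x) (f y) ≤ C * r * dist x y)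
    (hper : c ∉ Function.periodicPts f) {b : ℝ} (hb : 1 < b) :
    Tendsto (fun n : ℕ => Real.log (dist (f^[n] c) c) / (b ^ n + 1)) atTop (𝓝 0) := by
  set a := min (1 / (4 * C)) (ρ / 2)
  have ha0 : 0 < a := lt_min (by positivity) (by positivity)
  have hL0 : 0 < L := by linarith
  have hlower : Tendsto (fun n : ℕ => -(|Real.log a| * ((n : ℝ) ^ 0 / b ^ n)
      + Real.log L * ((n : ℝ) ^ 1 / b ^ n))) atTop (𝓝 0) := by
    simpa using (((tendsto_pow_const_div_const_pow_of_one_lt 0 hb).const_mul |Real.log a|).add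
      ((tendsto_pow_const_div_const_pow_of_one_lt 1 hb).const_mul (Real.log L))).neg
  refine tendsto_of_tendsto_of_tendsto_of_le_of_le' hlower tendsto_const_nhds ?_ ?_
  · filter_upwards [eventually_div_pow_le_dist_iterate hL hf hC hloc hper] with n hn
    have hbn : 0 < b ^ n := by positivity
    have hlog : Real.log a - n * Real.log L ≤ Real.log (dist (f^[n] c) c) := by
      rw [← Real.log_pow, ← Real.log_div ha0.ne' (by positivity)]
      exact Real.log_le_log (by positivity) hn
    have hlogL : 0 ≤ Real.log L := Real.log_nonneg hL.le
    have hnum : -(|Real.log a| + n * Real.log L) ≤ Real.log (dist (f^[n] c) c) := by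
      linarith [neg_abs_le (Real.log a)]
    have hpos : 0 ≤ |Real.log a| + n * Real.log L := by positivity
    calc -(|Real.log a| * ((n : ℝ) ^ 0 / b ^ n) + Real.log L * ((n : ℝ) ^ 1 / b ^ n))
        = -((|Real.log a| + n * Real.log L) / b ^ n) := by ring
      _ ≤ -((|Real.log a| + n * Real.log L) / (b ^ n + 1)) := by
          gcongr
          linarith
      _ = -(|Real.log a| + n * Real.log L) / (b ^ n + 1) := by rw [neg_div]
      _ ≤ _ := by gcongr
  · refine Eventually.of_forall fun n => div_nonpos_of_nonpos_of_nonneg ?_ (by positivity)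
    exact Real.log_nonpos dist_nonneg (hdist _)

end Recurrence

namespace P1

/-! ### The chordal metric -/

theorem norm_sq_eq (p : EuclideanSpace ℂ (Fin 2)) : ‖p‖ ^ 2 = ‖p 0‖ ^ 2 + ‖p 1‖ ^ 2 := by
  rw [EuclideanSpace.norm_sq_eq, Fin.sum_univ_two]

theorem inner_eq (p q : EuclideanSpace ℂ (Fin 2)) :
    inner ℂ p q = q 0 * (starRingEnd ℂ) (p 0) + q 1 * (starRingEnd ℂ) (p 1) := by
  simp [PiLp.inner_apply, Fin.sum_univ_two]

/-- Lagrange's identity. -/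
theorem norm_wedge_sq_add_norm_inner_sq (p q : EuclideanSpace ℂ (Fin 2)) :
    ‖wedge p q‖ ^ 2 + ‖inner ℂ p q‖ ^ 2 = ‖p‖ ^ 2 * ‖q‖ ^ 2 := by
  rw [norm_sq_eq, norm_sq_eq, inner_eq, wedge]
  simp only [← Complex.normSq_eq_norm_sq, Complex.normSq_apply, Complex.sub_re, Complex.sub_im,
    Complex.add_re, Complex.add_im, Complex.mul_re, Complex.mul_im, Complex.conj_re,
    Complex.conj_im]
  ring

theorem norm_wedge_le (p q : EuclideanSpace ℂ (Fin 2)) : ‖wedge p q‖ ≤ ‖p‖ * ‖q‖ := by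
  refine (sq_le_sq₀ (norm_nonneg _) (by positivity)).1 ?_
  rw [mul_pow, ← norm_wedge_sq_add_norm_inner_sq]
  linarith [sq_nonneg ‖inner ℂ p q‖]

/-- The Plücker relation for `p`, `q`, `r`, paired with `q`. -/
theorem wedge_mul_inner_self (p q r : EuclideanSpace ℂ (Fin 2)) :
    wedge p r * inner ℂ q q = wedge p q * inner ℂ q r + wedge q r * inner ℂ q p := by
  simp only [inner_eq, wedge]
  ring

theorem norm_wedge_mul_le (p q r : EuclideanSpace ℂ (Fin 2)) :
    ‖wedge p r‖ * ‖q‖ ^ 2 ≤ ‖wedge p q‖ * (‖q‖ * ‖r‖) + ‖wedge q r‖ * (‖q‖ * ‖p‖) := by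
  calc ‖wedge p r‖ * ‖q‖ ^ 2 = ‖wedge p r * inner ℂ q q‖ := by
        rw [norm_mul, inner_self_eq_norm_sq_to_K]
        simp
    _ ≤ ‖wedge p q‖ * ‖inner ℂ q r‖ + ‖wedge q r‖ * ‖inner ℂ q p‖ := by
        rw [wedge_mul_inner_self, ← norm_mul, ← norm_mul]
        exact norm_add_le _ _
    _ ≤ _ := by gcongr <;> exact norm_inner_le_norm _ _

theorem norm_wedge_comm (p q : EuclideanSpace ℂ (Fin 2)) : ‖wedge p q‖ = ‖wedge q p‖ := by
  rw [← norm_neg, wedge, wedge]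
  congr 1
  ring

theorem norm_rep_pos (x : P1) : 0 < ‖x.rep‖ := norm_pos_iff.2 x.rep_nonzero

theorem chordal_nonneg (x y : P1) : 0 ≤ chordal x y :=
  div_nonneg (norm_nonneg _) (by positivity)

theorem chordal_le_one (x y : P1) : chordal x y ≤ 1 :=
  div_le_one_of_le₀ (norm_wedge_le _ _) (by positivity)

theorem chordal_triangle (x y z : P1) : chordal x z ≤ chordal x y + chordal y z := by
  have hx := norm_rep_pos x
  have hy := norm_rep_pos y
  have hz := norm_rep_pos z
  have h := norm_wedge_mul_le x.rep y.rep z.rep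
  rw [chordal, chordal, chordal, div_add_div _ _ (by positivity) (by positivity),
    div_le_div_iff₀ (by positivity) (by positivity)]
  calc _ = (‖wedge x.rep z.rep‖ * ‖y.rep‖ ^ 2) * (‖x.rep‖ * ‖z.rep‖) := by ring
    _ ≤ _ := mul_le_mul_of_nonneg_right h (by positivity)
    _ = _ := by ring

theorem eq_of_chordal_eq_zero {x y : P1} (h : chordal x y = 0) : x = y := by
  have hx := norm_rep_pos x
  have hy := norm_rep_pos y
  rw [chordal, div_eq_zero_iff, norm_eq_zero, or_iff_left (by positivity)] at h
  have hinner : (inner ℂ y.rep y.rep : ℂ) ≠ 0 := inner_self_ne_zero.2 y.rep_nonzero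
  have h' : x.rep 0 * y.rep 1 = x.rep 1 * y.rep 0 := sub_eq_zero.1 h
  rw [← x.mk_rep, ← y.mk_rep, Projectivization.mk_eq_mk_iff']
  -- `x.rep` is its own orthogonal projection onto the line spanned by `y.rep`
  refine ⟨inner ℂ y.rep x.rep / inner ℂ y.rep y.rep, ?_⟩
  ext i
  rw [PiLp.smul_apply, smul_eq_mul, div_mul_eq_mul_div, div_eq_iff hinner, inner_eq, inner_eq]
  fin_cases i <;> simp only [Fin.zero_eta, Fin.mk_one]
  · linear_combination (-(starRingEnd ℂ) (y.rep 1)) * h'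
  · linear_combination (starRingEnd ℂ) (y.rep 0) * h'

/-- The projective line as a metric space under the chordal metric. -/
noncomputable abbrev chordalMetricSpace : MetricSpace P1 where
  dist := chordal
  dist_self x := by simp [chordal, wedge, mul_comm]
  dist_comm x y := by rw [chordal, chordal, norm_wedge_comm, mul_comm ‖x.rep‖]
  dist_triangle := chordal_triangle
  eq_of_dist_eq_zero := eq_of_chordal_eq_zero

/-- Two points of the projective line have unit representatives which are about as close in `ℂ²`
as the points are in the chordal metric: rotate one of them until their inner product is
nonnegative. -/
theorem exists_unit_rep_norm_sub_le (x y : P1) :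
    ∃ (p q : EuclideanSpace ℂ (Fin 2)) (hp : p ≠ 0) (hq : q ≠ 0),
      x = Projectivization.mk ℂ p hp ∧ y = Projectivization.mk ℂ q hq ∧ ‖p‖ = 1 ∧ ‖q‖ = 1 ∧
        ‖p - q‖ ≤ 2 * chordal x y := by
  have hunit : ∀ z : P1, ∃ (p : EuclideanSpace ℂ (Fin 2)) (hp : p ≠ 0),
      z = Projectivization.mk ℂ p hp ∧ ‖p‖ = 1 := by
    intro z
    have hz : ((‖z.rep‖ : ℂ)⁻¹) ≠ 0 := by simpa using z.rep_nonzero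
    refine ⟨(‖z.rep‖ : ℂ)⁻¹ • z.rep, smul_ne_zero hz z.rep_nonzero, ?_, ?_⟩
    · conv_lhs => rw [← z.mk_rep]
      rw [eq_comm, Projectivization.mk_eq_mk_iff']
      exact ⟨_, rfl⟩
    · have := (norm_rep_pos z).ne'
      rw [norm_smul, norm_inv, Complex.norm_real, norm_norm, inv_mul_cancel₀ this]
  obtain ⟨p, hp, rfl, hp1⟩ := hunit x
  obtain ⟨q, hq, rfl, hq1⟩ := hunit y
  obtain ⟨a, ha1, ha⟩ := Complex.exists_norm_eq_mul_self (inner ℂ p q)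
  have ha0 : a ≠ 0 := norm_ne_zero_iff.1 (by simp [ha1])
  refine ⟨p, a • q, hp, smul_ne_zero ha0 hq, rfl, ?_, hp1, by simp [norm_smul, ha1, hq1], ?_⟩
  · rw [eq_comm, Projectivization.mk_eq_mk_iff']
    exact ⟨a, rfl⟩
  · rw [chordal_mk, hp1, hq1]
    have hnn : 0 ≤ ‖wedge p q‖ := norm_nonneg _
    refine (sq_le_sq₀ (norm_nonneg _) (by positivity)).1 ?_
    have hlag := norm_wedge_sq_add_norm_inner_sq p q
    have hsub : ‖p - a • q‖ ^ 2 = 2 - 2 * ‖inner ℂ p q‖ := by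
      rw [norm_sub_sq (𝕜 := ℂ), norm_smul, inner_smul_right, ← ha, ha1, hp1, hq1]
      simp
      ring
    have hle : ‖inner ℂ p q‖ ≤ 1 := by simpa [hp1, hq1] using norm_inner_le_norm (𝕜 := ℂ) p q
    have h0 : 0 ≤ ‖inner ℂ p q‖ := norm_nonneg _
    rw [hp1, hq1] at hlag
    rw [hsub, one_mul, div_one, mul_pow]
    nlinarith

/-! ### Rational functions are Lipschitz -/

theorem chordal_mk_le_norm_sub_div (p q : EuclideanSpace ℂ (Fin 2)) (hp : p ≠ 0) (hq : q ≠ 0) :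
    chordal (Projectivization.mk ℂ p hp) (Projectivization.mk ℂ q hq) ≤ ‖p - q‖ / ‖p‖ := by
  have hp' := norm_pos_iff.2 hp
  have hq' := norm_pos_iff.2 hq
  have hw : wedge p q = wedge (p - q) q := by
    simp only [wedge, PiLp.sub_apply]
    ring
  rw [chordal_mk, hw, div_le_div_iff₀ (by positivity) hp']
  calc ‖wedge (p - q) q‖ * ‖p‖ ≤ (‖p - q‖ * ‖q‖) * ‖p‖ := by gcongr; exact norm_wedge_le _ _
    _ = _ := by ring

theorem analyticAt_eval (F : MvPolynomial (Fin 2) ℂ) {E : Type*} [NormedAddCommGroup E]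
    [NormedSpace ℂ E] {v : E → Fin 2 → ℂ} {z : E} (hv : ∀ i, AnalyticAt ℂ (v · i) z) :
    AnalyticAt ℂ (fun z => MvPolynomial.eval (v z) F) z := by
  simpa only [MvPolynomial.aeval_eq_eval] using AnalyticAt.aeval_mvPolynomial hv F

theorem contDiff_evalPair (F : Fin 2 → MvPolynomial (Fin 2) ℂ) :
    ContDiff ℂ 1 (evalPair F) := by
  rw [contDiff_euclidean]
  intro i
  rw [contDiff_iff_contDiffAt]
  intro p
  refine AnalyticAt.contDiffAt ?_
  refine analyticAt_eval (F i) fun k => ?_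
  exact (EuclideanSpace.proj k : EuclideanSpace ℂ (Fin 2) →L[ℂ] ℂ).analyticAt p

theorem IsRational.exists_lipschitz {f : P1 → P1} {d : ℕ} (hf : IsRational f d) :
    ∃ L : ℝ, 1 < L ∧ ∀ x y, chordal (f x) (f y) ≤ L * chordal x y := by
  obtain ⟨F, -, hF⟩ := hf
  have hsmooth := contDiff_evalPair F
  obtain ⟨K, hK⟩ := (hsmooth.locallyLipschitz.locallyLipschitzOn
    (s := Metric.sphere 0 1)).exists_lipschitzOnWith_of_compact (isCompact_sphere _ _)
  obtain ⟨u, hu, hmin⟩ := (isCompact_sphere (0 : EuclideanSpace ℂ (Fin 2)) 1).exists_isMinOn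
    ⟨EuclideanSpace.single 0 1, by simp⟩ hsmooth.continuous.norm.continuousOn
  have hu0 : u ≠ 0 := by
    rintro rfl
    simp at hu
  obtain ⟨hFu, -⟩ := hF u hu0
  have hm : 0 < ‖evalPair F u‖ := norm_pos_iff.2 hFu
  refine ⟨K * 2 / ‖evalPair F u‖ + 2, ?_, fun x y => ?_⟩
  · have : 0 ≤ K * 2 / ‖evalPair F u‖ := by positivity
    linarith
  obtain ⟨p, q, hp, hq, rfl, rfl, hp1, hq1, hpq⟩ := exists_unit_rep_norm_sub_le x y
  obtain ⟨hFp, hfp⟩ := hF p hp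
  obtain ⟨hFq, hfq⟩ := hF q hq
  have hps : p ∈ Metric.sphere (0 : EuclideanSpace ℂ (Fin 2)) 1 := by simpa using hp1
  have hqs : q ∈ Metric.sphere (0 : EuclideanSpace ℂ (Fin 2)) 1 := by simpa using hq1
  have hmp : ‖evalPair F u‖ ≤ ‖evalPair F p‖ := hmin hps
  have hlip : ‖evalPair F p - evalPair F q‖ ≤ K * ‖p - q‖ := hK.norm_sub_le hps hqs
  set s := chordal (Projectivization.mk ℂ p hp) (Projectivization.mk ℂ q hq)
  have hs : 0 ≤ s := chordal_nonneg _ _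
  rw [hfp, hfq]
  calc _ ≤ ‖evalPair F p - evalPair F q‖ / ‖evalPair F p‖ := chordal_mk_le_norm_sub_div _ _ _ _
    _ ≤ (K * (2 * s)) / ‖evalPair F u‖ := by
        gcongr
        exact hlip.trans (by gcongr)
    _ = (K * 2 / ‖evalPair F u‖) * s := by ring
    _ ≤ _ := by
        gcongr
        linarith

/-! ### Affine charts -/

theorem one_le_norm_affineVec (i : Fin 2) (z : ℂ) : 1 ≤ ‖affineVec i z‖ := by
  have h := PiLp.norm_apply_le (affineVec i z) i
  simpa [affineVec] using h

theorem norm_affineVec_le (i : Fin 2) (z w : ℂ) :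
    ‖affineVec i z‖ ≤ ‖affineVec i w‖ + ‖z - w‖ := by
  have h : affineVec i z - affineVec i w = EuclideanSpace.single (i + 1) (z - w) := by
    ext k
    fin_cases i <;> fin_cases k <;> simp [affineVec]
  have h' : ‖affineVec i z - affineVec i w‖ = ‖z - w‖ := by rw [h]; simp
  rw [← h', add_comm]
  exact norm_le_norm_sub_add _ _

theorem chordal_affinePoint (i : Fin 2) (z w : ℂ) :
    chordal (affinePoint i z) (affinePoint i w)
      = ‖z - w‖ / (‖affineVec i z‖ * ‖affineVec i w‖) := by
  rw [affinePoint, affinePoint, chordal_mk]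
  congr 1
  fin_cases i
  · simp [affineVec, wedge, norm_sub_rev]
  · simp [affineVec, wedge]

theorem chordal_affinePoint_le (i : Fin 2) (z w : ℂ) :
    chordal (affinePoint i z) (affinePoint i w) ≤ ‖z - w‖ := by
  rw [chordal_affinePoint]
  refine div_le_self (norm_nonneg _) ?_
  nlinarith [one_le_norm_affineVec i z, one_le_norm_affineVec i w]

theorem affineCoord_mk (i : Fin 2) (p : EuclideanSpace ℂ (Fin 2)) (hp : p ≠ 0) :
    affineCoord i (Projectivization.mk ℂ p hp) = p (i + 1) / p i := by
  obtain ⟨a, ha⟩ := Projectivization.exists_smul_eq_mk_rep ℂ p hp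
  rw [affineCoord, ← ha, Units.smul_def, PiLp.smul_apply, PiLp.smul_apply, smul_eq_mul,
    smul_eq_mul, mul_div_mul_left _ _ a.ne_zero]

theorem rep_mk_ne_zero_iff (i : Fin 2) (p : EuclideanSpace ℂ (Fin 2)) (hp : p ≠ 0) :
    (Projectivization.mk ℂ p hp).rep i ≠ 0 ↔ p i ≠ 0 := by
  obtain ⟨a, ha⟩ := Projectivization.exists_smul_eq_mk_rep ℂ p hp
  rw [← ha, Units.smul_def, PiLp.smul_apply, smul_eq_mul, mul_ne_zero_iff, and_iff_right a.ne_zero]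

theorem affinePoint_affineCoord {i : Fin 2} {x : P1} (hx : x.rep i ≠ 0) :
    affinePoint i (affineCoord i x) = x := by
  conv_rhs => rw [← x.mk_rep]
  rw [affinePoint, eq_comm, Projectivization.mk_eq_mk_iff']
  refine ⟨x.rep i, ?_⟩
  ext k
  fin_cases i <;> fin_cases k <;> simp_all [affineVec, affineCoord, mul_div_cancel₀]

theorem chordal_affinePoint_of_rep_eq_zero {i : Fin 2} {x : P1} (hx : x.rep i = 0) (w : ℂ) :
    chordal x (affinePoint i w) = 1 / ‖affineVec i w‖ := by
  have h0 := norm_rep_pos x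
  have hnorm : ‖wedge x.rep (affineVec i w)‖ = ‖x.rep‖ := by
    refine (sq_eq_sq₀ (norm_nonneg _) (norm_nonneg _)).1 ?_
    rw [norm_sq_eq x.rep]
    fin_cases i <;> simp_all [affineVec, wedge]
  rw [← x.mk_rep, affinePoint, chordal_mk, hnorm, div_mul_cancel_left₀ h0.ne', one_div]

/-- Near a point with nonzero `i`-th homogeneous coordinate, the `i`-th affine coordinate is
Lipschitz for the chordal metric. -/
theorem exists_affinePoint_of_chordal_le {i : Fin 2} {w : ℂ} {x : P1}
    (hx : chordal x (affinePoint i w) ≤ 1 / (2 * ‖affineVec i w‖)) :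
    ∃ z, x = affinePoint i z ∧ ‖affineVec i z‖ ≤ 2 * ‖affineVec i w‖ ∧
      ‖z - w‖ ≤ 2 * ‖affineVec i w‖ ^ 2 * chordal x (affinePoint i w) := by
  set V := ‖affineVec i w‖ with hV
  have hV1 : 1 ≤ V := one_le_norm_affineVec i w
  have hxi : x.rep i ≠ 0 := by
    intro h
    rw [chordal_affinePoint_of_rep_eq_zero h, ← hV, div_le_div_iff₀ (by linarith) (by linarith)]
      at hx
    linarith
  refine ⟨affineCoord i x, (affinePoint_affineCoord hxi).symm, ?_⟩
  obtain ⟨z, hz⟩ : ∃ z, affineCoord i x = z := ⟨_, rfl⟩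
  have hxz : x = affinePoint i z := by rw [← hz, affinePoint_affineCoord hxi]
  rw [hz]
  set s := chordal x (affinePoint i w) with hs
  have hU1 : 1 ≤ ‖affineVec i z‖ := one_le_norm_affineVec i z
  have hUV : ‖affineVec i z‖ ≤ V + ‖z - w‖ := norm_affineVec_le i z w
  have hs' : ‖z - w‖ = s * (‖affineVec i z‖ * V) := by
    rw [hs, hxz, chordal_affinePoint, ← hV, div_mul_cancel₀]
    positivity
  have hs0 : 0 ≤ s := chordal_nonneg _ _
  have hsV : s * V ≤ 1 / 2 := by
    rw [le_div_iff₀ (by linarith)] at hx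
    linarith
  have hhalf : ‖z - w‖ ≤ s * V * V + 1 / 2 * ‖z - w‖ := by
    calc ‖z - w‖ = (s * V) * ‖affineVec i z‖ := by rw [hs']; ring
      _ ≤ (s * V) * (V + ‖z - w‖) := by gcongr
      _ = s * V * V + (s * V) * ‖z - w‖ := by ring
      _ ≤ _ := by gcongr
  constructor <;> nlinarith

/-! ### Contraction near a critical point -/

/-- An analytic function is Lipschitz on small discs around a critical point, with a constant
proportional to the radius. -/
theorem exists_norm_sub_le_mul_of_hasDerivAt_zero {g : ℂ → ℂ} {w : ℂ} (hg : AnalyticAt ℂ g w)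
    (hg0 : HasDerivAt g 0 w) :
    ∃ A > 0, ∃ δ > 0, ∀ r < δ, ∀ z₁ z₂, ‖z₁ - w‖ ≤ r → ‖z₂ - w‖ ≤ r →
      ‖g z₁ - g z₂‖ ≤ A * r * ‖z₁ - z₂‖ := by
  obtain ⟨A, hA, hbound⟩ := hg.deriv.differentiableAt.isBigO_sub.exists_pos
  obtain ⟨δ, hδ, hball⟩ := Metric.eventually_nhds_iff_ball.1
    (hbound.bound.and hg.eventually_analyticAt)
  refine ⟨A, hA, δ, hδ, fun r hr z₁ z₂ h₁ h₂ => ?_⟩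
  have hsub : ∀ z ∈ Metric.closedBall w r, z ∈ Metric.ball w δ :=
    fun z hz => Metric.closedBall_subset_ball hr hz
  refine (convex_closedBall w r).norm_image_sub_le_of_norm_deriv_le (𝕜 := ℂ)
    (fun z hz => (hball z (hsub z hz)).2.differentiableAt) (fun z hz => ?_)
    (by simpa [dist_eq_norm] using h₂) (by simpa [dist_eq_norm] using h₁)
  have h := (hball z (hsub z hz)).1
  rw [hg0.deriv, sub_zero] at h
  refine h.trans ?_
  gcongr
  simpa [dist_eq_norm] using hz

theorem analyticAt_evalPair_affineVec (F : Fin 2 → MvPolynomial (Fin 2) ℂ) (i j : Fin 2) (z : ℂ) :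
    AnalyticAt ℂ (fun z => evalPair F (affineVec i z) j) z := by
  refine analyticAt_eval (F j) fun k => ?_
  by_cases h : k = i
  · simpa [affineVec, h] using analyticAt_const
  · simp only [affineVec, h, if_false]
    exact analyticAt_id

/-- Near a critical point `c`, a rational function contracts chordal distances by a factor
proportional to the distance from `c`: its expression in affine charts is analytic with vanishing
derivative, and the charts are bi-Lipschitz near the points in question. -/
theorem IsRational.exists_contraction {f : P1 → P1} {d : ℕ} (hf : IsRational f d) {c : P1}
    (hc : IsCriticalPoint f c) :
    ∃ C > 0, ∃ ρ > 0, ∀ r ≤ ρ, ∀ x y, chordal x c ≤ r → chordal y c ≤ r →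
      chordal (f x) (f y) ≤ C * r * chordal x y := by
  obtain ⟨F, -, hF⟩ := hf
  obtain ⟨i, j, hi, hj, hderiv⟩ := hc
  set w := affineCoord i c
  have hcw : c = affinePoint i w := (affinePoint_affineCoord hi).symm
  set g : ℂ → ℂ := fun z => affineCoord j (f (affinePoint i z))
  have hfz : ∀ z, ∃ h : evalPair F (affineVec i z) ≠ 0,
      f (affinePoint i z) = Projectivization.mk ℂ (evalPair F (affineVec i z)) h :=
    fun z => hF _ (affineVec_ne_zero i z)
  have hgF : g = fun z => evalPair F (affineVec i z) (j + 1) / evalPair F (affineVec i z) j := by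
    funext z
    obtain ⟨h, hfz⟩ := hfz z
    rw [← affineCoord_mk j _ h, ← hfz]
  have hjw : evalPair F (affineVec i w) j ≠ 0 := by
    obtain ⟨h, hfw⟩ := hfz w
    rwa [hcw, hfw, rep_mk_ne_zero_iff] at hj
  have hgan : AnalyticAt ℂ g w := by
    rw [hgF]
    exact (analyticAt_evalPair_affineVec F i _ w).div (analyticAt_evalPair_affineVec F i j w) hjw
  obtain ⟨A, hA, δ, hδ, hlip⟩ := exists_norm_sub_le_mul_of_hasDerivAt_zero hgan hderiv
  obtain ⟨η, hη, hne⟩ := Metric.eventually_nhds_iff_ball.1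
    ((analyticAt_evalPair_affineVec F i j w).continuousAt.eventually_ne hjw)
  have hfg : ∀ z, ‖z - w‖ < η → f (affinePoint i z) = affinePoint j (g z) := by
    intro z hz
    refine (affinePoint_affineCoord ?_).symm
    obtain ⟨h, hfz⟩ := hfz z
    rw [hfz, rep_mk_ne_zero_iff]
    exact hne z (by simpa [dist_eq_norm] using hz)
  set V := ‖affineVec i w‖
  have hV1 : 1 ≤ V := one_le_norm_affineVec i w
  -- The affine coordinate is `2 V ^ 2`-Lipschitz from `c` and `4 V ^ 2`-Lipschitz near `c`; the
  -- radius keeps it within `min δ η / 2` of `w`.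
  refine ⟨A * (2 * V ^ 2) * (4 * V ^ 2), by positivity,
    min (1 / (2 * V)) (min δ η / (4 * V ^ 2)), by positivity, fun r hr x y hx hy => ?_⟩
  obtain ⟨hr1, hr2⟩ := le_min_iff.1 hr
  rw [hcw] at hx hy
  obtain ⟨z₁, rfl, hn₁, hz₁⟩ := exists_affinePoint_of_chordal_le (hx.trans hr1)
  obtain ⟨z₂, rfl, hn₂, hz₂⟩ := exists_affinePoint_of_chordal_le (hy.trans hr1)
  have hd₁ : ‖z₁ - w‖ ≤ 2 * V ^ 2 * r := hz₁.trans (by gcongr)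
  have hd₂ : ‖z₂ - w‖ ≤ 2 * V ^ 2 * r := hz₂.trans (by gcongr)
  have hmin : 0 < min δ η := lt_min hδ hη
  have hrs : 2 * V ^ 2 * r < min δ η := by
    rw [le_div_iff₀ (by positivity)] at hr2
    linarith
  obtain ⟨hrδ, hrη⟩ := lt_min_iff.1 hrs
  have hr0 : 0 ≤ r := (chordal_nonneg _ _).trans hx
  have hdist : ‖z₁ - z₂‖ ≤ 4 * V ^ 2 * chordal (affinePoint i z₁) (affinePoint i z₂) := by
    have h₁ := one_le_norm_affineVec i z₁
    have h₂ := one_le_norm_affineVec i z₂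
    have hs := chordal_nonneg (affinePoint i z₁) (affinePoint i z₂)
    calc ‖z₁ - z₂‖ = chordal (affinePoint i z₁) (affinePoint i z₂)
          * (‖affineVec i z₁‖ * ‖affineVec i z₂‖) := by
          rw [chordal_affinePoint, div_mul_cancel₀]
          positivity
      _ ≤ chordal (affinePoint i z₁) (affinePoint i z₂) * ((2 * V) * (2 * V)) := by gcongr
      _ = _ := by ring
  rw [hfg z₁ (hd₁.trans_lt hrη), hfg z₂ (hd₂.trans_lt hrη)]
  calc _ ≤ ‖g z₁ - g z₂‖ := chordal_affinePoint_le _ _ _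
    _ ≤ A * (2 * V ^ 2 * r) * ‖z₁ - z₂‖ := hlip _ hrδ _ _ hd₁ hd₂
    _ ≤ A * (2 * V ^ 2 * r) * (4 * V ^ 2 * chordal (affinePoint i z₁) (affinePoint i z₂)) := by
        gcongr
    _ = _ := by ring

end P1

/-! ### Recurrence of critical points -/

theorem mainTheorem3 (f : P1 → P1) (d : ℕ) (hd : 1 < d) (hf : P1.IsRational f d) (c : P1)
    (hc : P1.IsCriticalPoint f c) (hper : c ∉ Function.periodicPts f) :
    Tendsto (fun n : ℕ => Real.log (P1.chordal (f^[n] c) c) / ((d : ℝ) ^ n + 1))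
      atTop (𝓝 0) := by
  let _ := P1.chordalMetricSpace
  obtain ⟨L, hL, hlip⟩ := hf.exists_lipschitz
  obtain ⟨C, hC, ρ, hρ, hloc⟩ := hf.exists_contraction hc
  exact tendsto_log_dist_iterate_div (fun x => P1.chordal_le_one x c) hL hlip hC hρ hloc hper
    (by exact_mod_cast hd)
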